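/- **Setting.** Let $\mathbb K$ be a field of characteristic zero (for example $\mathbb R$, $\mathbb C$, or an algebraically closed field of characteristic zero) with a topology, $X$ a topological space and $\mathcal O_X$ a sheaf of $\mathbb K$-algebras of continuous $\mathbb K$-valued functions on $X$. A *Lie algebroid* over $(X,\mathcal O_X)$ is a sheaf $\mathcal E$ of $\mathcal O_X$-modules and of $\mathbb K$-Lie algebras with an anchor $\mathfrak a:\mathcal E\to \mathcal Der_{\mathbb K_X}(\mathcal O_X)$ that is a morphism of $\mathcal O_X$-modules and of sheaves of Lie algebras and satisfies $[D,fD']=f[D,D']+\mathfrak a(D)(f)D'$. Fix a Lie algebroid $\mathcal L$. An *$\mathcal L$-Lie algebroid* is a Lie algebroid $\mathcal E$ with a morphism of Lie algebroids $\mathcal E\to\mathcal L$ (an $\mathcal O_X$-linear morphism of sheaves of Lie algebras commuting with the anchors). **Definition.** Let $\mathcal E,\mathcal F$ be $\mathcal L$-Lie algebroids with an $\mathcal O_X$-bilinear pairing $\langle\cdot,\cdot\rangle:\mathcal E\times\mathcal F\to\mathcal O_X$. The pair $(\mathcal E,\mathcal F)$ is an *$\mathcal L$-Lie bialgebroid*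 if 1. $\mathcal E$ and $\mathcal F$ are locally free $\mathcal O_X$-modules of finite rank; 2. $\mathcal E$ and $\mathcal F$ are in duality: $\xi\mapsto\langle\cdot,\xi\rangle$ is an isomorphism $\mathcal F\cong\mathcal E^*=\mathscr Hom_{\mathcal O_X}(\mathcal E,\mathcal O_X)$; 3. for all local sections $D_1,D_2$ of $\mathcal E$, $$d_*[D_1,D_2]=[d_*D_1,D_2]+[D_1,d_*D_2]\quad\text{in }\wedge^2_{\mathcal O_X}\mathcal E .$$ Here $d_*D\in\wedge^2\mathcal E\cong\mathscr Hom_{\mathcal O_X}(\wedge^2\mathcal F,\mathcal O_X)$ is the Chevalley–Eilenberg–de Rham differential, for the Lie algebroid $\mathcal F$, of the $1$-form $\langle D,\cdot\rangle$ on $\mathcal F$: $$(d_*D)(\xi,\eta)=\mathfrak a_{\mathcal F}(\xi)\langle D,\eta\rangle-\mathfrak a_{\mathcal F}(\eta)\langle D,\xi\rangle-\langle D,[\xi,\eta]_{\mathcal F}\rangle ,$$ and the brackets are the Gerstenhaber (Schouten) brackets on $\wedge^\bullet_{\mathcal O_X}\mathcal E$ of the Lie algebroid $\mathcal E$: $[D,\cdot]$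 is the derivation of $\wedge^\bullet\mathcal E$ extending $\mathfrak a_{\mathcal E}(D)$ on $\mathcal O_X$ and $[D,\cdot]_{\mathcal E}$ on $\mathcal E$, and $[P,D]=-[D,P]$. **Proposition.** Let $\mathcal L',\mathcal L'^*$ be $\mathcal L$-Lie algebroids with an $\mathcal O_X$-bilinear pairing $\mathcal L'\times\mathcal L'^*\to\mathcal O_X$. Then $(\mathcal L',\mathcal L'^*)$ is an $\mathcal L$-Lie bialgebroid if and only if $(\mathcal L'^*,\mathcal L')$, with the same pairing with its two arguments exchanged, is an $\mathcal L$-Lie bialgebroid. -/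

import Mathlib

open TopologicalSpace

universe u v w w₁ w₂ w₃

/-! ## The Gerstenhaber bracket with a section on the exterior algebra of a Lie-Rinehart algebra -/

section Gerstenhaber

variable {A : Type u} {M : Type v} [CommRing A] [LieRing M] [Module A M] [LieRingModule M A]

/-- The ring `Λ ⊕ ε Λ` (with `ε² = 0`) over the exterior algebra `Λ` of `M`, which is viewed below
as an `A`-algebra through `a ↦ a + ε ⁅X, a⁆`. -/
def TwistedDualNumbers (A : Type u) {M : Type v} [CommRing A] [LieRing M] [Module A M]
    [LieRingModule M A] (_X : M) : Type (max u v) :=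
  TrivSqZeroExt (ExteriorAlgebra A M) (ExteriorAlgebra A M)

noncomputable instance (X : M) : Ring (TwistedDualNumbers A X) :=
  inferInstanceAs (Ring (TrivSqZeroExt (ExteriorAlgebra A M) (ExteriorAlgebra A M)))

namespace TwistedDualNumbers

/-- The element `P + ε Q`. -/
def mk (X : M) (P Q : ExteriorAlgebra A M) : TwistedDualNumbers A X := (P, Q)

/-- The component `P` of `P + ε Q`. -/
def re {X : M} (z : TwistedDualNumbers A X) : ExteriorAlgebra A M := z.1

/-- The component `Q` of `P + ε Q`. -/
def im {X : M} (z : TwistedDualNumbers A X) : ExteriorAlgebra A M := z.2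

@[ext] theorem ext {X : M} {z z' : TwistedDualNumbers A X} (h₁ : z.re = z'.re)
    (h₂ : z.im = z'.im) : z = z' := Prod.ext h₁ h₂

section
variable {X : M}

@[simp] theorem re_mk (P Q : ExteriorAlgebra A M) : (mk X P Q).re = P := rfl
@[simp] theorem im_mk (P Q : ExteriorAlgebra A M) : (mk X P Q).im = Q := rfl
@[simp] theorem re_zero : (0 : TwistedDualNumbers A X).re = 0 := rfl
@[simp] theorem im_zero : (0 : TwistedDualNumbers A X).im = 0 := rfl
@[simp] theorem re_one : (1 : TwistedDualNumbers A X).re = 1 := rfl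
@[simp] theorem im_one : (1 : TwistedDualNumbers A X).im = 0 := rfl
@[simp] theorem re_add (z z' : TwistedDualNumbers A X) : (z + z').re = z.re + z'.re := rfl
@[simp] theorem im_add (z z' : TwistedDualNumbers A X) : (z + z').im = z.im + z'.im := rfl
@[simp] theorem re_mul (z z' : TwistedDualNumbers A X) : (z * z').re = z.re * z'.re := rfl
@[simp] theorem im_mul (z z' : TwistedDualNumbers A X) :
    (z * z').im = z.re * z'.im + z.im * z'.re := rfl

end

/-- The ring map `a ↦ a + ε ⁅X, a⁆`. -/
noncomputable def scalars [LieRinehartRing A M] (X : M) : A →+* TwistedDualNumbers A X where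
  toFun a := mk X (algebraMap A _ a) (algebraMap A _ ⁅X, a⁆)
  map_one' := by
    have h : ⁅X, (1 : A)⁆ = 0 := by
      have := LieRinehartRing.leibniz_mul_right X (1 : A) 1
      simpa using this
    ext <;> simp [h]
  map_mul' a b := by ext <;> simp only [LieRinehartRing.leibniz_mul_right, re_mk, im_mk, re_mul,
    im_mul, map_mul, map_add, smul_eq_mul]
  map_zero' := by ext <;> simp only [re_mk, im_mk, re_zero, im_zero, lie_zero, map_zero]
  map_add' a b := by ext <;> simp only [re_mk, im_mk, re_add, im_add, lie_add, map_add]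

noncomputable instance [LieRinehartRing A M] (X : M) : Algebra A (TwistedDualNumbers A X) :=
  RingHom.toAlgebra' (scalars X) (by
    intro a z
    ext
    · exact Algebra.commutes a z.re
    · change _ * _ + _ * _ = _ * _ + _ * _
      rw [add_comm]
      exact congrArg₂ _ (Algebra.commutes _ z.re) (Algebra.commutes _ z.im))

theorem re_algebraMap [LieRinehartRing A M] {X : M} (a : A) :
    (algebraMap A (TwistedDualNumbers A X) a).re = algebraMap A _ a := rfl

theorem im_algebraMap [LieRinehartRing A M] {X : M} (a : A) :
    (algebraMap A (TwistedDualNumbers A X) a).im = algebraMap A _ ⁅X, a⁆ := rfl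

theorem smul_eq [LieRinehartRing A M] {X : M} (a : A) (z : TwistedDualNumbers A X) :
    a • z = mk X (a • z.re) (a • z.im + ⁅X, a⁆ • z.re) := by
  rw [Algebra.smul_def]
  ext
  · simp [re_algebraMap, Algebra.smul_def]
  · simp [re_algebraMap, im_algebraMap, Algebra.smul_def]

/-- The projection `P + ε Q ↦ P`. -/
noncomputable def reHom [LieRinehartRing A M] (X : M) :
    TwistedDualNumbers A X →ₐ[A] ExteriorAlgebra A M where
  toFun := re
  map_one' := rfl
  map_mul' _ _ := rfl
  map_zero' := rfl
  map_add' _ _ := rfl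
  commutes' _ := rfl

end TwistedDualNumbers

open TwistedDualNumbers in
/-- The `A`-algebra map `Λ → Λ ⊕ ε Λ` with `Y ↦ Y + ε ⁅X, Y⁆` for `Y` in `M`; it has the form
`P ↦ P + ε [X, P]`. -/
noncomputable def gerstenhaberLift [LieRinehartRing A M] (X : M) :
    ExteriorAlgebra A M →ₐ[A] TwistedDualNumbers A X :=
  ExteriorAlgebra.lift A
    ⟨{  toFun := fun Y => mk X (ExteriorAlgebra.ι A Y) (ExteriorAlgebra.ι A ⁅X, Y⁆)
        map_add' := fun Y Z => by ext <;> simp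
        map_smul' := fun a Y => by
          rw [RingHom.id_apply, smul_eq]
          ext <;> simp [LieRinehartRing.leibniz_smul_right] },
      fun Y => by
        ext
        · simp
        · simp only [LinearMap.coe_mk, AddHom.coe_mk, im_mul, re_mk, im_mk, im_zero]
          exact ExteriorAlgebra.ι_add_mul_swap Y ⁅X, Y⁆⟩

/-- The Gerstenhaber bracket `[X, P]` of an element `X` of a Lie-Rinehart algebra `M` and an
element `P` of its exterior algebra: the derivation (of degree `0`) of the exterior algebra which is
the anchor action `a ↦ ⁅X, a⁆` on `A` and the Lie bracket `Y ↦ ⁅X, Y⁆` on `M`. -/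
noncomputable def gerstenhaberLeft [LieRinehartRing A M] (X : M) (P : ExteriorAlgebra A M) :
    ExteriorAlgebra A M :=
  (gerstenhaberLift X P).im

/-- The Gerstenhaber bracket `[P, X] = - [X, P]` (graded skew-symmetry
`[P, Q] = - (-1) ^ ((|P| - 1) (|Q| - 1)) [Q, P]`, with `|X| = 1`). -/
noncomputable def gerstenhaberRight [LieRinehartRing A M] (P : ExteriorAlgebra A M) (X : M) :
    ExteriorAlgebra A M :=
  - gerstenhaberLeft X P

theorem gerstenhaberLift_re [LieRinehartRing A M] (X : M) (P : ExteriorAlgebra A M) :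
    (gerstenhaberLift X P).re = P := by
  have h : (TwistedDualNumbers.reHom X).comp (gerstenhaberLift X) =
      AlgHom.id A (ExteriorAlgebra A M) := by
    apply ExteriorAlgebra.hom_ext
    ext Y
    simp only [gerstenhaberLift, LinearMap.comp_apply, AlgHom.toLinearMap_apply, AlgHom.comp_apply,
      ExteriorAlgebra.lift_ι_apply]
    rfl
  exact DFunLike.congr_fun h P

theorem gerstenhaberLeft_algebraMap [LieRinehartRing A M] (X : M) (a : A) :
    gerstenhaberLeft X (algebraMap A (ExteriorAlgebra A M) a) = algebraMap A _ ⁅X, a⁆ := by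
  rw [gerstenhaberLeft, AlgHom.commutes, TwistedDualNumbers.im_algebraMap]

theorem gerstenhaberLeft_ι [LieRinehartRing A M] (X Y : M) :
    gerstenhaberLeft X (ExteriorAlgebra.ι A Y) = ExteriorAlgebra.ι A ⁅X, Y⁆ := by
  rw [gerstenhaberLeft, gerstenhaberLift, ExteriorAlgebra.lift_ι_apply]
  rfl

theorem gerstenhaberLeft_add [LieRinehartRing A M] (X : M) (P Q : ExteriorAlgebra A M) :
    gerstenhaberLeft X (P + Q) = gerstenhaberLeft X P + gerstenhaberLeft X Q := by
  simp [gerstenhaberLeft]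

theorem gerstenhaberLeft_mul [LieRinehartRing A M] (X : M) (P Q : ExteriorAlgebra A M) :
    gerstenhaberLeft X (P * Q) = gerstenhaberLeft X P * Q + P * gerstenhaberLeft X Q := by
  simp [gerstenhaberLeft, gerstenhaberLift_re, add_comm]

end Gerstenhaber

/-! ## The Chevalley-Eilenberg differential of a Lie-Rinehart algebra in degree one -/

section Differential

variable {A : Type u} {M : Type v} {N : Type w} [CommRing A]

/-- The Chevalley-Eilenberg-de Rham differential of a `1`-form `ω` on a Lie-Rinehart algebra `N`,
`(d ω)(ξ, η) = ⁅ξ, ω η⁆ - ⁅η, ω ξ⁆ - ω ⁅ξ, η⁆`. -/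
noncomputable def chevalleyEilenbergOne [LieRing N] [Module A N] [LieRingModule N A]
    [LieRinehartRing A N] (ω : N →ₗ[A] A) : N [⋀^Fin 2]→ₗ[A] A where
  toFun x := ⁅x 0, ω (x 1)⁆ - ⁅x 1, ω (x 0)⁆ - ω ⁅x 0, x 1⁆
  map_update_add' := by
    intro inst x i y z
    rw [Subsingleton.elim inst (instDecidableEqFin 2)]
    fin_cases i <;> simp <;> ring
  map_update_smul' := by
    intro inst x i a y
    rw [Subsingleton.elim inst (instDecidableEqFin 2)]
    fin_cases i
    · have h : ⁅a • y, x 1⁆ = a • ⁅y, x 1⁆ - ⁅x 1, a⁆ • y := by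
        rw [← lie_skew, LieRinehartRing.leibniz_smul_right, ← lie_skew y (x 1)]
        simp only [smul_neg, neg_add]; abel
      simp [h]; ring
    · simp; ring
  map_eq_zero_of_eq' x i j hij hne := by
    have h : x 0 = x 1 := by
      fin_cases i <;> fin_cases j <;> simp_all
    simp [h]

variable [AddCommGroup M] [Module A M] [AddCommGroup N] [Module A N]

/-- The `A`-linear map from bivectors on `M` to `2`-forms on `N` induced by a bilinear pairing `B`
of `M` and `N`: `X ∧ Y ↦ ((ξ, η) ↦ B X ξ * B Y η - B X η * B Y ξ)`. -/
noncomputable def bivectorToForm (B : M →ₗ[A] N →ₗ[A] A) :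
    ⋀[A]^2 M →ₗ[A] N [⋀^Fin 2]→ₗ[A] A :=
  (exteriorPower.alternatingMapLinearEquiv (R := A) (M := N) (N := A) (n := 2)).symm.toLinearMap ∘ₗ
    exteriorPower.pairingDual A N 2 ∘ₗ exteriorPower.map 2 B

theorem bivectorToForm_apply (B : M →ₗ[A] N →ₗ[A] A) (X Y : M) (ξ η : N) :
    bivectorToForm B (exteriorPower.ιMulti A 2 ![X, Y]) ![ξ, η] =
      B X ξ * B Y η - B X η * B Y ξ := by
  simp [bivectorToForm, exteriorPower.alternatingMapLinearEquiv_symm_apply,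
    exteriorPower.map_apply_ιMulti, Matrix.det_fin_two, mul_comm (B Y ξ)]

open Module in
theorem bivectorToForm_bijective (B : M →ₗ[A] N →ₗ[A] A) {n : ℕ} (b : Basis (Fin n) A M)
    (hB : Function.Bijective B.flip) : Function.Bijective (bivectorToForm B) := by
  classical
  let c : Basis (Fin n) A N := b.dualBasis.map (LinearEquiv.ofBijective B.flip hB).symm
  have hc : ∀ i j, B (b i) (c j) = if j = i then 1 else 0 := by
    intro i j
    have h : B.flip (c j) = b.dualBasis j := by
      simp only [c, Basis.map_apply]
      exact (LinearEquiv.ofBijective B.flip hB).apply_symm_apply _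
    rw [← LinearMap.flip_apply, h, Basis.dualBasis_apply_self]
    simp [eq_comm]
  have hBb : ∀ i, B (b i) = c.coord i := by
    intro i
    apply c.ext
    intro j
    rw [hc, Basis.coord_apply, Basis.repr_self, Finsupp.single_apply]
  have key : ∀ s, (exteriorPower.pairingDual A N 2 ∘ₗ exteriorPower.map 2 B) (b.exteriorPower 2 s)
      = (c.exteriorPower 2).coord s := by
    intro s
    rw [exteriorPower.basis_coord, exteriorPower.basis_apply, LinearMap.comp_apply,
      exteriorPower.map_apply_ιMulti_family]
    have : (⇑B ∘ ⇑b) = (fun i => c.coord i) := funext hBb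
    rw [this]
    rfl
  have hbij : Function.Bijective (exteriorPower.pairingDual A N 2 ∘ₗ exteriorPower.map 2 B) := by
    have : exteriorPower.pairingDual A N 2 ∘ₗ exteriorPower.map 2 B =
        ((b.exteriorPower 2).equiv (c.exteriorPower 2).dualBasis (Equiv.refl _)).toLinearMap := by
      apply (b.exteriorPower 2).ext
      intro s
      rw [key, LinearEquiv.coe_coe, Basis.equiv_apply, Basis.coe_dualBasis, Equiv.refl_apply]
    rw [this]
    exact LinearEquiv.bijective _
  exact (exteriorPower.alternatingMapLinearEquiv (R := A) (M := N) (N := A)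
    (n := 2)).symm.bijective.comp hbij

end Differential

/-! ## Topological ringed spaces and Lie algebroids -/

/-- The structure sheaf of a topological ringed space `(X, 𝒪)`: a sheaf of `K`-algebras of
continuous `K`-valued functions on the topological space `X`.  The topology on `K` may be any one
(such as the Euclidean topology of `ℝ` or `ℂ`, or the Zariski topology). -/
structure StructureSheafOn (K : Type w) [Field K] [TopologicalSpace K]
    (X : Type u) [TopologicalSpace X] where
  /-- the functions over an open set -/
  carrier : ∀ U : Opens X, Subalgebra K (U → K)
  continuous_of_mem : ∀ {U : Opens X} {f : U → K}, f ∈ carrier U → Continuous f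
  restrict_mem : ∀ {U V : Opens X} (h : V ≤ U) {f : U → K}, f ∈ carrier U →
    (fun x : V => f ⟨x.1, h x.2⟩) ∈ carrier V
  mem_of_locally_mem : ∀ {U : Opens X} (f : U → K),
    (∀ x ∈ U, ∃ (V : Opens X) (h : V ≤ U), x ∈ V ∧ (fun y : V => f ⟨y.1, h y.2⟩) ∈ carrier V) →
    f ∈ carrier U

section Geometry

variable {K : Type w} [Field K] [TopologicalSpace K] {X : Type u} [TopologicalSpace X]

/-- The `K`-algebra of sections of `𝒪` over `U`. -/
def StructureSheafOn.sections (O : StructureSheafOn K X) (U : Opens X) : Type (max u w) :=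
  O.carrier U

instance (O : StructureSheafOn K X) (U : Opens X) : CommRing (O.sections U) :=
  inferInstanceAs (CommRing (O.carrier U))

instance (O : StructureSheafOn K X) (U : Opens X) : Algebra K (O.sections U) :=
  inferInstanceAs (Algebra K (O.carrier U))

/-- Restriction of functions. -/
def StructureSheafOn.res (O : StructureSheafOn K X) {U V : Opens X} (h : V ≤ U) :
    O.sections U →ₐ[K] O.sections V where
  toFun f := ⟨fun x => f.1 ⟨x.1, h x.2⟩, O.restrict_mem h f.2⟩
  map_one' := rfl
  map_mul' _ _ := rfl
  map_zero' := rfl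
  map_add' _ _ := rfl
  commutes' _ := rfl

/-- A Lie algebroid over `(X, 𝒪)`: a sheaf of `(K, 𝒪)`-Lie-Rinehart algebras, that is, a sheaf of
`K`-Lie algebras which is a sheaf of `𝒪`-modules, with an `𝒪`-linear anchor `D ↦ (f ↦ ⁅D, f⁆)` with
values in the `K`-linear derivations of `𝒪` which is a morphism of sheaves of Lie algebras and
satisfies `⁅D, f • D'⁆ = f • ⁅D, D'⁆ + ⁅D, f⁆ • D'`. -/
structure LieAlgebroid (O : StructureSheafOn K X) where
  /-- the sections over an open set -/
  Sec : Opens X → Type v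
  [lieRing : ∀ U, LieRing (Sec U)]
  [lieAlgebra : ∀ U, LieAlgebra K (Sec U)]
  [module : ∀ U, Module (O.sections U) (Sec U)]
  /-- the anchor: `⁅D, f⁆` is the derivative of the function `f` along the section `D` -/
  [lieRingModule : ∀ U, LieRingModule (Sec U) (O.sections U)]
  [lieRinehartRing : ∀ U, LieRinehartRing (O.sections U) (Sec U)]
  [lieRinehartAlgebra : ∀ U, LieRinehartAlgebra K (O.sections U) (Sec U)]
  /-- restriction: it is compatible with brackets, scalars and anchors -/
  res : ∀ {U V : Opens X} (h : V ≤ U), LieRinehartAlgebra.Hom (O.res h) (Sec U) (Sec V)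
  res_self : ∀ {U : Opens X} (D : Sec U), res le_rfl D = D
  res_res : ∀ {U V W : Opens X} (h : V ≤ U) (h' : W ≤ V) (D : Sec U),
    res h' (res h D) = res (h'.trans h) D
  existsUnique_gluing : ∀ {ι : Type u} (U : ι → Opens X) (s : ∀ i, Sec (U i)),
    (∀ i j, res (U := U i) (V := U i ⊓ U j) inf_le_left (s i) =
      res (U := U j) (V := U i ⊓ U j) inf_le_right (s j)) →
    ∃! D : Sec (⨆ i, U i), ∀ i, res (U := ⨆ i, U i) (V := U i) (le_iSup U i) D = s i

attribute [instance] LieAlgebroid.lieRing LieAlgebroid.lieAlgebra LieAlgebroid.module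
  LieAlgebroid.lieRingModule LieAlgebroid.lieRinehartRing LieAlgebroid.lieRinehartAlgebra

variable {O : StructureSheafOn K X}

/-- A morphism of Lie algebroids over `(X, 𝒪)`: a morphism of sheaves that is `𝒪`-linear, preserves
the Lie brackets and commutes with the anchors. -/
structure LieAlgebroid.Hom (E : LieAlgebroid.{u, w₁, w} O) (L : LieAlgebroid.{u, w₂, w} O) where
  app : ∀ U : Opens X, LieRinehartAlgebra.Hom (AlgHom.id K (O.sections U)) (E.Sec U) (L.Sec U)
  app_res : ∀ {U V : Opens X} (h : V ≤ U) (D : E.Sec U), app V (E.res h D) = L.res h (app U D)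

/-- An `ℒ`-Lie algebroid `(ℒ', φ)`: a Lie algebroid with a morphism of Lie algebroids to `ℒ`. -/
structure LieAlgebroidOver (L : LieAlgebroid.{u, w₂, w} O) where
  toLieAlgebroid : LieAlgebroid.{u, w₁, w} O
  toBase : toLieAlgebroid.Hom L

namespace LieAlgebroid

/-- `E` is free of finite rank over `U`: there are finitely many sections over `U` whose
restrictions to every open `V ⊆ U` are a basis, i.e. `E|_U ≅ 𝒪|_U ^ n`. -/
def IsFreeOn (E : LieAlgebroid.{u, w₁, w} O) (U : Opens X) : Prop :=
  ∃ (n : ℕ) (e : Fin n → E.Sec U), ∀ (V : Opens X) (h : V ≤ U),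
    LinearIndependent (O.sections V) (fun i => E.res h (e i)) ∧
      ⊤ ≤ Submodule.span (O.sections V) (Set.range fun i => E.res h (e i))

/-- `E` is a locally free `𝒪`-module of finite rank. -/
def IsLocallyFree (E : LieAlgebroid.{u, w₁, w} O) : Prop :=
  ∀ x : X, ∃ U : Opens X, x ∈ U ∧ E.IsFreeOn U

/-- The sections over `U` of the dual sheaf `ℰ^* = ℋom_𝒪(ℰ, 𝒪)`: the `𝒪|_U`-linear morphisms of
sheaves from `ℰ|_U` to `𝒪|_U`. -/
@[ext] structure DualSection (E : LieAlgebroid.{u, w₁, w} O) (U : Opens X) where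
  app : ∀ V : Opens X, V ≤ U → (E.Sec V →ₗ[O.sections V] O.sections V)
  app_res : ∀ {V W : Opens X} (hV : V ≤ U) (hW : W ≤ V) (D : E.Sec V),
    app W (hW.trans hV) (E.res hW D) = O.res hW (app V hV D)

end LieAlgebroid

/-- An `𝒪`-bilinear pairing of sheaves `ℰ × ℱ → 𝒪`. -/
structure SheafPairing (E : LieAlgebroid.{u, w₁, w} O) (F : LieAlgebroid.{u, w₂, w} O) where
  app : ∀ U : Opens X, E.Sec U →ₗ[O.sections U] F.Sec U →ₗ[O.sections U] O.sections U
  app_res : ∀ {U V : Opens X} (h : V ≤ U) (D : E.Sec U) (ξ : F.Sec U),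
    app V (E.res h D) (F.res h ξ) = O.res h (app U D ξ)

namespace SheafPairing

variable {E : LieAlgebroid.{u, w₁, w} O} {F : LieAlgebroid.{u, w₂, w} O}

/-- The same pairing with the two sheaves exchanged. -/
def flip (p : SheafPairing E F) : SheafPairing F E where
  app U := (p.app U).flip
  app_res h ξ D := p.app_res h D ξ

/-- The morphism `ℱ → ℰ^*`, `ξ ↦ ⟨·, ξ⟩`, given by the pairing. -/
def toDual (p : SheafPairing E F) (U : Opens X) (ξ : F.Sec U) : E.DualSection U where
  app V h := (p.app V).flip (F.res h ξ)
  app_res {V W} hV hW D := by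
    have := p.app_res hW D (F.res hV ξ)
    rw [F.res_res] at this
    exact this

/-- The pairing identifies `ℱ` with the dual sheaf `ℰ^*`. -/
def IsDual (p : SheafPairing E F) : Prop :=
  ∀ U : Opens X, Function.Bijective (p.toDual U)

theorem bijective_flip_app (p : SheafPairing E F) (hp : p.IsDual) {U : Opens X} {n : ℕ}
    {e : Fin n → E.Sec U} (he : ∀ (V : Opens X) (h : V ≤ U),
      LinearIndependent (O.sections V) (fun i => E.res h (e i)) ∧
        ⊤ ≤ Submodule.span (O.sections V) (Set.range fun i => E.res h (e i))) :
    Function.Bijective (p.app U).flip := by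
  constructor
  · intro ξ η h
    apply (hp U).1
    apply LieAlgebroid.DualSection.ext
    funext V hV
    apply LinearMap.ext_on (top_le_iff.mp (he V hV).2)
    rintro _ ⟨i, rfl⟩
    change p.app V (E.res hV (e i)) (F.res hV ξ) = p.app V (E.res hV (e i)) (F.res hV η)
    rw [p.app_res, p.app_res]
    exact congrArg _ (LinearMap.congr_fun h (e i))
  · intro φ
    let b : ∀ (V : Opens X) (h : V ≤ U), Module.Basis (Fin n) (O.sections V) (E.Sec V) :=
      fun V h => Module.Basis.mk (he V h).1 (he V h).2
    have hb : ∀ (V : Opens X) (h : V ≤ U) (i : Fin n), b V h i = E.res h (e i) := fun V h i => by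
      simp [b]
    obtain ⟨ξ, hξ⟩ := (hp U).2
      { app := fun V h => (b V h).constr ℕ (fun i => O.res h (φ (e i)))
        app_res := by
          intro V W hV hW D
          obtain ⟨c, rfl⟩ : ∃ c : Fin n → O.sections V, D = ∑ i, c i • E.res hV (e i) :=
            ⟨(b V hV).repr D, by
              conv_lhs => rw [← (b V hV).sum_repr D]
              simp only [hb]⟩
          have h1 : ∀ c : Fin n → O.sections V, E.res hW (∑ i, c i • E.res hV (e i)) =
              ∑ i, O.res hW (c i) • E.res (hW.trans hV) (e i) := by
            intro c
            change (E.res hW).toLinearMap' _ = _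
            rw [map_sum]
            refine Finset.sum_congr rfl fun i _ => ?_
            rw [LieRinehartAlgebra.Hom.toLinearMap'_apply, LieRinehartAlgebra.Hom.map_smul_apply,
              E.res_res]
          rw [h1, map_sum, map_sum, map_sum]
          refine Finset.sum_congr rfl fun i _ => ?_
          rw [map_smul, map_smul, ← hb W, ← hb V, Module.Basis.constr_basis,
            Module.Basis.constr_basis, smul_eq_mul, smul_eq_mul, map_mul]
          rfl }
    refine ⟨ξ, ?_⟩
    have h2 := congrArg (fun d : E.DualSection U => d.app U le_rfl) hξ
    apply LinearMap.ext_on (top_le_iff.mp (he U le_rfl).2)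
    rintro _ ⟨i, rfl⟩
    have h3 := LinearMap.congr_fun h2 (E.res le_rfl (e i))
    change p.app U _ (F.res le_rfl ξ) = (b U le_rfl).constr ℕ _ _ at h3
    rw [F.res_self] at h3
    rw [LinearMap.flip_apply, h3, ← hb U, Module.Basis.constr_basis]
    change O.res le_rfl (φ (e i)) = φ (E.res le_rfl (e i))
    rw [E.res_self]
    rfl

theorem bivectorToForm_bijective (p : SheafPairing E F) (hp : p.IsDual) {U : Opens X}
    (hU : E.IsFreeOn U) : Function.Bijective (bivectorToForm (p.app U)) := by
  obtain ⟨n, e, he⟩ := hU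
  exact _root_.bivectorToForm_bijective (p.app U)
    (Module.Basis.mk (he U le_rfl).1 (he U le_rfl).2) (p.bijective_flip_app hp he)

/-- For `ℱ = ℰ^*`, the isomorphism from `Λ²ℰ` to the `2`-forms on `ℱ` over an open set on which `ℰ`
is free. -/
noncomputable def bivectorEquiv (p : SheafPairing E F) (hp : p.IsDual) {U : Opens X}
    (hU : E.IsFreeOn U) :
    ⋀[O.sections U]^2 (E.Sec U) ≃ₗ[O.sections U] F.Sec U [⋀^Fin 2]→ₗ[O.sections U] O.sections U :=
  LinearEquiv.ofBijective _ (p.bivectorToForm_bijective hp hU)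

/-- For `ℱ = ℰ^*`, the differential `d_* : ℰ → Λ²ℰ` defined by the Lie algebroid structure of `ℱ`,
over an open set on which `ℰ` is free: a section `D` of `ℰ` is regarded as the `1`-form `⟨D, ·⟩` on
`ℱ`, and its Chevalley-Eilenberg differential, a `2`-form on `ℱ`, as a section of `Λ²ℰ`. -/
noncomputable def dStar (p : SheafPairing E F) (hp : p.IsDual) {U : Opens X}
    (hU : E.IsFreeOn U) (D : E.Sec U) : ⋀[O.sections U]^2 (E.Sec U) :=
  (p.bivectorEquiv hp hU).symm (chevalleyEilenbergOne (p.app U D))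

end SheafPairing

/-- `ℒ`-Lie bialgebroids: `ℰ` and `ℱ` are `ℒ`-Lie algebroids, locally free of finite rank, in duality
through the pairing `p` (which identifies `ℱ` with `ℰ^*`), such that
`d_* ⁅D₁, D₂⁆ = [d_* D₁, D₂] + [D₁, d_* D₂]` for all sections `D₁`, `D₂` of `ℰ`, where `d_*` comes
from the Lie algebroid `ℱ` and the brackets are the Gerstenhaber brackets of the Lie algebroid `ℰ`.

`Λ²ℰ` is the sheaf associated with `U ↦ ⋀²_{𝒪(U)} ℰ(U)`.  Its sections over the open sets on which
`ℰ` is free, which form a basis of the topology, are the elements of `⋀²_{𝒪(U)} ℰ(U)`; so the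
identity of sections of `Λ²ℰ` is imposed over all these open sets. -/
structure IsLieBialgebroid {L : LieAlgebroid.{u, w₃, w} O} (E : LieAlgebroidOver.{u, w, w₁, w₃} L)
    (F : LieAlgebroidOver.{u, w, w₂, w₃} L)
    (p : SheafPairing E.toLieAlgebroid F.toLieAlgebroid) : Prop where
  isLocallyFree_left : E.toLieAlgebroid.IsLocallyFree
  isLocallyFree_right : F.toLieAlgebroid.IsLocallyFree
  isDual : p.IsDual
  compatibility : ∀ (U : Opens X) (hU : E.toLieAlgebroid.IsFreeOn U)
    (D₁ D₂ : E.toLieAlgebroid.Sec U),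
    (p.dStar isDual hU ⁅D₁, D₂⁆ : ExteriorAlgebra (O.sections U) (E.toLieAlgebroid.Sec U)) =
      gerstenhaberRight (p.dStar isDual hU D₁ : ExteriorAlgebra (O.sections U) _) D₂ +
        gerstenhaberLeft D₁ (p.dStar isDual hU D₂ : ExteriorAlgebra (O.sections U) _)

end Geometry

/-! ### Lie derivatives and defects over one Lie-Rinehart pair. -/

section CartanCalculus

variable {A : Type u} {M : Type v} {N : Type w} [CommRing A] [LieRing M] [Module A M]
  [LieRingModule M A] [LieRinehartRing A M]

/-! Over an open set with dual frames, write `T(X, Y; ξ, η)` for the value on `(ξ, η)` of `d_*⁅X, Y⁆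
- [d_*X, Y] - [X, d_*Y]`. The bracket of `X` with a bivector is the Lie derivative of the
corresponding form on the dual, so `T` can be written with anchors, brackets, the pairing and Lie
derivatives only (`bialgebroidDefect_eq`). In that form it is almost symmetric in the two
algebroids: exchanging them changes `T` only by commutators of anchors, collected in the anchor
defect `S(X, ξ, f)`, and by sums `⁅df, g⁆ + ⁅dg, f⁆` (`bialgebroidDefect_flip`).

These corrections vanish as soon as `T` does. Replacing `Y` by `f • Y` in `T = 0` gives `S(X, ξ, f)
⟨Y, η⟩ = S(X, η, f) ⟨Y, ξ⟩` (`bialgebroidDefect_smul`), and in rank at least two dual frames force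
`S = 0`. Replacing then `X` by `g • X` in `S = 0` leaves `⁅dg, f⁆ + ⁅df, g⁆ = 0`
(`smul_anchorDefect`). In rank at most one there are no nonzero `2`-forms, so both compatibilities
are trivial.

The sheaf part supplies the frames: a frame on either side has a dual frame, and local reflexivity
together with gluing turns `ℱ ≅ ℰ^*` into `ℰ ≅ ℱ^*`. One implication suffices, since exchanging
twice restores the pairing. -/

theorem LieRinehartRing.leibniz_smul_left (a : A) (X Y : M) :
    ⁅a • X, Y⁆ = a • ⁅X, Y⁆ - ⁅Y, a⁆ • X := by
  rw [← lie_skew, LieRinehartRing.leibniz_smul_right, ← lie_skew X Y]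
  simp only [smul_neg, neg_add]
  abel

/-! ### Lie derivatives transported to the dual module. -/

section LieDerivative

variable [AddCommGroup N] [Module A N]

/-- The Lie derivative along `X` of the `1`-form `⟨·, ξ⟩` on `M`, as an element of the dual module
`N` of `M`. -/
noncomputable def lieDerivative (B : M →ₗ[A] N →ₗ[A] A) (hB : Function.Bijective B.flip) (X : M)
    (ξ : N) : N :=
  (LinearEquiv.ofBijective B.flip hB).symm
    { toFun := fun Y => ⁅X, B Y ξ⁆ - B ⁅X, Y⁆ ξ
      map_add' := fun Y Z => by simp; ring
      map_smul' := fun a Y => by simp; ring }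

/-- The differential of `f`, as an element of the dual module `N` of `M`. -/
noncomputable def pairingGradient (B : M →ₗ[A] N →ₗ[A] A) (hB : Function.Bijective B.flip) (f : A) : N :=
  (LinearEquiv.ofBijective B.flip hB).symm
    { toFun := fun Y => ⁅Y, f⁆
      map_add' := fun Y Z => by simp
      map_smul' := fun a Y => by simp }

variable {B : M →ₗ[A] N →ₗ[A] A} (hB : Function.Bijective B.flip)

theorem pairing_lieDerivative (X Y : M) (ξ : N) :
    B Y (lieDerivative B hB X ξ) = ⁅X, B Y ξ⁆ - B ⁅X, Y⁆ ξ :=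
  LinearMap.congr_fun ((LinearEquiv.ofBijective B.flip hB).apply_symm_apply _) Y

theorem pairing_pairingGradient (f : A) (Y : M) : B Y (pairingGradient B hB f) = ⁅Y, f⁆ :=
  LinearMap.congr_fun ((LinearEquiv.ofBijective B.flip hB).apply_symm_apply _) Y

omit [LieRingModule M A] [LieRinehartRing A M] in
include hB in
theorem eq_of_pairing_eq {ξ η : N} (h : ∀ Y, B Y ξ = B Y η) : ξ = η :=
  hB.1 (LinearMap.ext h)

theorem lieDerivative_smul (X : M) (a : A) (ξ : N) :
    lieDerivative B hB X (a • ξ) = a • lieDerivative B hB X ξ + ⁅X, a⁆ • ξ :=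
  eq_of_pairing_eq hB fun Y => by simp [pairing_lieDerivative]; ring

/-- Cartan's rule `L_{aX} = a L_X + da ∧ ι_X`. The failure of linearity in `X` is where the brackets
`⁅df, g⁆` enter the later computations. -/
theorem smul_lieDerivative (X : M) (a : A) (ξ : N) :
    lieDerivative B hB (a • X) ξ = a • lieDerivative B hB X ξ + B X ξ • pairingGradient B hB a :=
  eq_of_pairing_eq hB fun Y => by
    simp [pairing_lieDerivative, pairing_pairingGradient, LieRinehartRing.leibniz_smul_left]; ring

/-- The Gerstenhaber bracket of `X` with a bivector is the bivector whose associated form is the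
Lie derivative of the form associated with the given bivector. -/
theorem exists_coe_eq_gerstenhaberLeft (X : M) (P : ⋀[A]^2 M) :
    ∃ Q : ⋀[A]^2 M, (Q : ExteriorAlgebra A M) = gerstenhaberLeft X (P : ExteriorAlgebra A M) ∧
      ∀ ξ η, bivectorToForm B Q ![ξ, η] = ⁅X, bivectorToForm B P ![ξ, η]⁆ -
        bivectorToForm B P ![lieDerivative B hB X ξ, η] -
        bivectorToForm B P ![ξ, lieDerivative B hB X η] := by
  -- Both sides are derivations over the anchor of `X`, so decomposable bivectors suffice. The
  -- existential form also records that the bracket stays in degree two, which the exterior-algebra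
  -- bracket does not show by its type.
  have hP : P ∈ Submodule.span A (Set.range (exteriorPower.ιMulti A 2 (M := M))) := by
    rw [exteriorPower.ιMulti_span]; trivial
  induction hP using Submodule.span_induction with
  | mem P h =>
    obtain ⟨y, rfl⟩ := h
    obtain ⟨Y, Z, rfl⟩ : ∃ Y Z, y = ![Y, Z] := ⟨y 0, y 1, by ext i; fin_cases i <;> rfl⟩
    refine ⟨exteriorPower.ιMulti A 2 ![⁅X, Y⁆, Z] + exteriorPower.ιMulti A 2 ![Y, ⁅X, Z⁆], ?_, ?_⟩
    · simp [ExteriorAlgebra.ιMulti_apply, gerstenhaberLeft_mul, gerstenhaberLeft_ι]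
    · intro ξ η
      simp only [map_add, AlternatingMap.add_apply, bivectorToForm_apply, pairing_lieDerivative,
        lie_sub, LieRinehartRing.leibniz_mul_right, smul_eq_mul]
      ring
  | zero =>
    refine ⟨0, ?_, fun ξ η => by simp⟩
    have := gerstenhaberLeft_algebraMap X (0 : A)
    simpa using this.symm
  | add P P' _ _ h h' =>
    obtain ⟨Q, hQ, hQf⟩ := h
    obtain ⟨Q', hQ', hQf'⟩ := h'
    refine ⟨Q + Q', by simp [gerstenhaberLeft_add, hQ, hQ'], fun ξ η => ?_⟩
    simp only [map_add, AlternatingMap.add_apply, hQf, hQf', lie_add]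
    ring
  | smul a P _ h =>
    obtain ⟨Q, hQ, hQf⟩ := h
    refine ⟨a • Q + ⁅X, a⁆ • P, ?_, fun ξ η => ?_⟩
    · simp [Algebra.smul_def, gerstenhaberLeft_mul, gerstenhaberLeft_algebraMap, hQ, add_comm]
    · simp only [map_add, map_smul, AlternatingMap.add_apply, AlternatingMap.smul_apply, hQf,
        smul_eq_mul, LieRinehartRing.leibniz_mul_right]
      ring

end LieDerivative

/-! ### Compatibility as a defect, and its behaviour under duality. -/

section Pair

variable [LieRing N] [Module A N] [LieRingModule N A] [LieRinehartRing A N]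

theorem chevalleyEilenbergOne_apply (ω : N →ₗ[A] A) (ξ η : N) :
    chevalleyEilenbergOne ω ![ξ, η] = ⁅ξ, ω η⁆ - ⁅η, ω ξ⁆ - ω ⁅ξ, η⁆ := rfl

/-- The failure of the identity `d_* ⁅X, Y⁆ = [d_* X, Y] + [X, d_* Y]`, evaluated on `ξ` and `η`
and expressed in terms of Lie derivatives. -/
noncomputable def bialgebroidDefect (B : M →ₗ[A] N →ₗ[A] A) (hB : Function.Bijective B.flip)
    (hB' : Function.Bijective B.flip.flip) (X Y : M) (ξ η : N) : A :=
  ⁅ξ, B ⁅X, Y⁆ η⁆ - ⁅η, B ⁅X, Y⁆ ξ⁆ - B ⁅X, Y⁆ ⁅ξ, η⁆ + ⁅X, B Y ⁅ξ, η⁆⁆ - ⁅Y, B X ⁅ξ, η⁆⁆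
    - (⁅X, ⁅ξ, B Y η⁆⁆ - ⁅X, ⁅η, B Y ξ⁆⁆ - ⁅Y, ⁅ξ, B X η⁆⁆ + ⁅Y, ⁅η, B X ξ⁆⁆)
    + (⁅lieDerivative B hB X ξ, B Y η⁆ - ⁅lieDerivative B hB X η, B Y ξ⁆
      - ⁅lieDerivative B hB Y ξ, B X η⁆ + ⁅lieDerivative B hB Y η, B X ξ⁆)
    - B (lieDerivative B.flip hB' η Y) (lieDerivative B hB X ξ)
    + B (lieDerivative B.flip hB' ξ Y) (lieDerivative B hB X η)
    + B (lieDerivative B.flip hB' η X) (lieDerivative B hB Y ξ)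
    - B (lieDerivative B.flip hB' ξ X) (lieDerivative B hB Y η)

/-- The failure of `L_X ξ - L_ξ X` to have the anchor `⁅a X, a ξ⁆`, evaluated
on `f` and corrected by the bracket `⁅df, ⟨X, ξ⟩⁆`. -/
noncomputable def anchorDefect (B : M →ₗ[A] N →ₗ[A] A) (hB : Function.Bijective B.flip)
    (hB' : Function.Bijective B.flip.flip) (X : M) (ξ : N) (f : A) : A :=
  ⁅X, ⁅ξ, f⁆⁆ - ⁅ξ, ⁅X, f⁆⁆ - ⁅lieDerivative B hB X ξ, f⁆ + ⁅lieDerivative B.flip hB' ξ X, f⁆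
    - ⁅pairingGradient B hB f, B X ξ⁆

variable {B : M →ₗ[A] N →ₗ[A] A} (hB : Function.Bijective B.flip)
  (hB' : Function.Bijective B.flip.flip)

omit [LieRingModule M A] [LieRinehartRing A M] in
theorem pairing_lieDerivative_flip (X : M) (ξ η : N) :
    B (lieDerivative B.flip hB' ξ X) η = ⁅ξ, B X η⁆ - B X ⁅ξ, η⁆ :=
  pairing_lieDerivative hB' ξ η X

theorem bialgebroidDefect_eq (X Y : M) (ξ η : N) :
    bialgebroidDefect B hB hB' X Y ξ η = chevalleyEilenbergOne (B ⁅X, Y⁆) ![ξ, η] -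
      (⁅X, chevalleyEilenbergOne (B Y) ![ξ, η]⁆ -
        chevalleyEilenbergOne (B Y) ![lieDerivative B hB X ξ, η] -
        chevalleyEilenbergOne (B Y) ![ξ, lieDerivative B hB X η]) +
      (⁅Y, chevalleyEilenbergOne (B X) ![ξ, η]⁆ -
        chevalleyEilenbergOne (B X) ![lieDerivative B hB Y ξ, η] -
        chevalleyEilenbergOne (B X) ![ξ, lieDerivative B hB Y η]) := by
  simp only [chevalleyEilenbergOne_apply, bialgebroidDefect, pairing_lieDerivative_flip, lie_sub]
  -- With `η` in first place, these brackets match the ones coming from `L_η Y` and `L_η X`.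
  rw [← lie_skew (lieDerivative B hB X ξ) η, ← lie_skew (lieDerivative B hB Y ξ) η]
  simp only [map_neg]
  ring

/-- All terms that differentiate `f` assemble into anchor defects, so the vanishing of `T` for every
`Y` constrains the anchors. -/
theorem bialgebroidDefect_smul (X Y : M) (ξ η : N) (f : A) :
    bialgebroidDefect B hB hB' X (f • Y) ξ η = f * bialgebroidDefect B hB hB' X Y ξ η -
      (anchorDefect B hB hB' X ξ f * B Y η - anchorDefect B hB hB' X η f * B Y ξ) := by
  simp only [bialgebroidDefect, anchorDefect, pairing_lieDerivative_flip,
    smul_lieDerivative, lieDerivative_smul, pairing_pairingGradient,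
    LieRinehartRing.leibniz_smul_right, LieRinehartRing.leibniz_mul_right, add_lie, lie_add,
    LieRinehartRing.lie_smul_eq_mul, map_add, map_smul, LinearMap.add_apply, LinearMap.smul_apply,
    smul_eq_mul]
  simp only [pairing_lieDerivative, lie_sub]
  ring

/-- The terms containing `⁅X, Y⁆` or `⁅ξ, η⁆` and those pairing two Lie derivatives are symmetric
under the exchange. Only the iterated anchors and the anchors of Lie derivatives change. The
gradient brackets compensate for the last term in the definition of `anchorDefect`. -/
theorem bialgebroidDefect_flip (X Y : M) (ξ η : N) :
    bialgebroidDefect B.flip hB' hB ξ η X Y = bialgebroidDefect B hB hB' X Y ξ η +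
      (anchorDefect B hB hB' X ξ (B Y η) - anchorDefect B hB hB' X η (B Y ξ)
        - anchorDefect B hB hB' Y ξ (B X η) + anchorDefect B hB hB' Y η (B X ξ))
      + (⁅pairingGradient B hB (B Y η), B X ξ⁆ + ⁅pairingGradient B hB (B X ξ), B Y η⁆)
      - (⁅pairingGradient B hB (B Y ξ), B X η⁆ + ⁅pairingGradient B hB (B X η), B Y ξ⁆) := by
  have hflip : lieDerivative B.flip.flip hB = lieDerivative B hB := rfl
  simp only [bialgebroidDefect, anchorDefect, hflip, LinearMap.flip_apply]
  ring

theorem smul_anchorDefect (X : M) (ξ : N) (f g : A) :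
    anchorDefect B hB hB' (g • X) ξ f = g * anchorDefect B hB hB' X ξ f -
      B X ξ * (⁅pairingGradient B hB g, f⁆ + ⁅pairingGradient B hB f, g⁆) := by
  simp only [anchorDefect, smul_lieDerivative, lieDerivative_smul, add_lie,
    LieRinehartRing.lie_smul_eq_mul, map_smul, LinearMap.smul_apply,
    smul_eq_mul, LieRinehartRing.leibniz_mul_right]
  ring

/-- Over dual frames, the vanishing of the defect for `(M, N)` implies the vanishing of the defect
for `(N, M)`. -/
theorem bialgebroidDefect_flip_eq_zero {n : ℕ} (e : Module.Basis (Fin n) A M) (f : Fin n → N)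
    (hef : ∀ i j, B (e i) (f j) = if i = j then 1 else 0)
    (h : ∀ X Y ξ η, bialgebroidDefect B hB hB' X Y ξ η = 0) (X Y : M) (ξ η : N) :
    bialgebroidDefect B.flip hB' hB ξ η X Y = 0 := by
  obtain hn | hn := subsingleton_or_nontrivial (Fin n)
  -- Rank at most one: two distinct frame indices are missing, but the defect is built from
  -- `2`-forms on `M`, all zero.
  · have h0 : ∀ ω : M [⋀^Fin 2]→ₗ[A] A, ω = 0 := fun ω => e.ext_alternating fun v hv =>
      absurd (hv (Subsingleton.elim (v 0) (v 1))) (by simp)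
    refine (bialgebroidDefect_eq (B := B.flip) hB' hB ξ η X Y).trans ?_
    simp [h0 (chevalleyEilenbergOne _)]
  have h1 : ∀ X Y ξ η g, anchorDefect B hB hB' X ξ g * B Y η =
      anchorDefect B hB hB' X η g * B Y ξ := by
    intro X Y ξ η g
    have := bialgebroidDefect_smul hB hB' X Y ξ η g
    rw [h, h] at this
    linear_combination this
  have h2 : ∀ X j g, anchorDefect B hB hB' X (f j) g = 0 := by
    intro X j g
    obtain ⟨k, hk⟩ := exists_ne j
    -- Here `⟨e k, f k⟩ = 1` and `⟨e k, f j⟩ = 0`, which isolates the defect at `f j`.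
    simpa [hef, hk] using h1 X (e k) (f j) (f k) g
  have h3 : ∀ X ξ g, anchorDefect B hB hB' X ξ g = 0 := by
    intro X ξ g
    obtain ⟨j, -⟩ := exists_pair_ne (Fin n)
    -- The right side now has the factor `S(X, f j, g) = 0`, so linearity of `S` in `ξ` is not
    -- needed.
    simpa [hef, h2] using h1 X (e j) ξ (f j) g
  have h4 : ∀ g g' : A, ⁅pairingGradient B hB g, g'⁆ + ⁅pairingGradient B hB g', g⁆ = 0 := by
    intro g g'
    obtain ⟨j, -⟩ := exists_pair_ne (Fin n)
    -- Since `⟨e j, f j⟩ = 1`, the correction term is exactly the symmetrised bracket.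
    have := smul_anchorDefect hB hB' (e j) (f j) g' g
    rw [h3, h3, hef, if_pos rfl] at this
    linear_combination this
  rw [bialgebroidDefect_flip, h, h4, h4]
  simp [h3]

/-- Both sides of the compatibility are bivectors, and a bivector is determined by the values of its
form; these differ by the defect. -/
theorem compatibility_iff_bialgebroidDefect_eq_zero (hb : Function.Bijective (bivectorToForm B))
    (X Y : M) :
    (((LinearEquiv.ofBijective _ hb).symm (chevalleyEilenbergOne (B ⁅X, Y⁆)) : ⋀[A]^2 M) :
        ExteriorAlgebra A M) =
      gerstenhaberRight (((LinearEquiv.ofBijective _ hb).symm (chevalleyEilenbergOne (B X)) :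
        ⋀[A]^2 M) : ExteriorAlgebra A M) Y +
      gerstenhaberLeft X (((LinearEquiv.ofBijective _ hb).symm (chevalleyEilenbergOne (B Y)) :
        ⋀[A]^2 M) : ExteriorAlgebra A M) ↔
    ∀ ξ η, bialgebroidDefect B hB hB' X Y ξ η = 0 := by
  obtain ⟨P, hP, hPf⟩ := exists_coe_eq_gerstenhaberLeft hB Y
    ((LinearEquiv.ofBijective _ hb).symm (chevalleyEilenbergOne (B X)))
  obtain ⟨Q, hQ, hQf⟩ := exists_coe_eq_gerstenhaberLeft hB X
    ((LinearEquiv.ofBijective _ hb).symm (chevalleyEilenbergOne (B Y)))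
  have hs : ∀ ω, bivectorToForm B ((LinearEquiv.ofBijective _ hb).symm ω) = ω :=
    (LinearEquiv.ofBijective _ hb).apply_symm_apply
  rw [hs] at hPf hQf
  rw [gerstenhaberRight, ← hP, ← hQ, ← Submodule.coe_neg, ← Submodule.coe_add, Subtype.coe_inj,
    LinearEquiv.symm_apply_eq, LinearEquiv.ofBijective_apply]
  have hext : ∀ ω ω' : N [⋀^Fin 2]→ₗ[A] A, ω = ω' ↔ ∀ ξ η, ω ![ξ, η] = ω' ![ξ, η] := by
    refine fun ω ω' => ⟨fun h ξ η => by rw [h], fun h => AlternatingMap.ext fun x => ?_⟩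
    have hx : x = ![x 0, x 1] := by ext i; fin_cases i <;> rfl
    rw [hx, h]
  rw [hext]
  refine forall₂_congr fun ξ η => ?_
  rw [bialgebroidDefect_eq, map_add, map_neg, AlternatingMap.add_apply, AlternatingMap.neg_apply,
    hPf, hQf, ← sub_eq_zero]
  exact Eq.congr_left (by ring)

end Pair
end CartanCalculus

/-! ### Local equality, gluing and frames of sheaves. -/

section Sheaves

variable {K : Type w} [Field K] [TopologicalSpace K] {X : Type u} [TopologicalSpace X]
  {O : StructureSheafOn K X}

theorem StructureSheafOn.eq_of_locally_eq {U : Opens X} {f g : O.sections U}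
    (h : ∀ x ∈ U, ∃ (V : Opens X) (hV : V ≤ U), x ∈ V ∧ O.res hV f = O.res hV g) : f = g := by
  apply Subtype.ext
  funext x
  obtain ⟨V, hV, hx, hfg⟩ := h x x.2
  exact congrFun (congrArg Subtype.val hfg) ⟨x, hx⟩

namespace LieAlgebroid

variable {E : LieAlgebroid.{u, w₁, w} O}

/-- The sections `e i` over `U` form a frame of `E` over `U`. -/
def IsFrame (E : LieAlgebroid.{u, w₁, w} O) {U : Opens X} {n : ℕ} (e : Fin n → E.Sec U) : Prop :=
  ∀ (V : Opens X) (h : V ≤ U), LinearIndependent (O.sections V) (fun i => E.res h (e i)) ∧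
    ⊤ ≤ Submodule.span (O.sections V) (Set.range fun i => E.res h (e i))

theorem IsFrame.restrict {U V : Opens X} {n : ℕ} {e : Fin n → E.Sec U} (he : E.IsFrame e)
    (h : V ≤ U) : E.IsFrame fun i => E.res h (e i) := by
  intro W hW
  simp only [E.res_res]
  exact he W (hW.trans h)

theorem existsUnique_gluing' {ι : Type u} (V : ι → Opens X) {U : Opens X} (hU : ⨆ i, V i = U)
    (s : ∀ i, E.Sec (V i))
    (hs : ∀ i j, E.res (U := V i) (V := V i ⊓ V j) inf_le_left (s i) =
      E.res (U := V j) (V := V i ⊓ V j) inf_le_right (s j)) :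
    ∃! D : E.Sec U, ∀ i, E.res ((le_iSup V i).trans_eq hU) D = s i := by
  subst hU
  exact E.existsUnique_gluing V s hs

theorem eq_of_locally_eq {U : Opens X} {D D' : E.Sec U}
    (h : ∀ x ∈ U, ∃ (V : Opens X) (hV : V ≤ U), x ∈ V ∧ E.res hV D = E.res hV D') : D = D' := by
  choose V hV hx hD using h
  have hU : ⨆ x : U, V x x.2 = U := by
    refine le_antisymm (iSup_le fun x => hV _ _) fun x hxU => ?_
    exact (le_iSup (fun x : U => V x x.2) ⟨x, hxU⟩) (hx x hxU)
  refine (existsUnique_gluing' _ hU (fun x => E.res (hV x x.2) D) ?_).unique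
    (fun x => rfl) (fun x => (hD x x.2).symm)
  intro i j
  simp only [E.res_res]

end LieAlgebroid

/-! ### Dual frames and reflexivity. -/

namespace SheafPairing

open LieAlgebroid

variable {E : LieAlgebroid.{u, w₁, w} O} {F : LieAlgebroid.{u, w₂, w} O} {p : SheafPairing E F}

/-- A frame of `ℰ` has a dual frame in `ℱ = ℰ^*`. -/
theorem exists_dual_frame (hp : p.IsDual) {U : Opens X} {n : ℕ} {e : Fin n → E.Sec U}
    (he : E.IsFrame e) : ∃ f : Fin n → F.Sec U, F.IsFrame f ∧
      ∀ i j, p.app U (e i) (f j) = if i = j then 1 else 0 := by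
  classical
  let b : ∀ (V : Opens X) (h : V ≤ U), Module.Basis (Fin n) (O.sections V) (E.Sec V) :=
    fun V h => Module.Basis.mk (he V h).1 (he V h).2
  have hb : ∀ (V : Opens X) (h : V ≤ U) (i : Fin n), b V h i = E.res h (e i) := fun V h i => by
    simp [b]
  have hbij : ∀ (V : Opens X) (h : V ≤ U), Function.Bijective (p.app V).flip := fun V h =>
    p.bijective_flip_app hp (he.restrict h)
  let c : ∀ (V : Opens X) (h : V ≤ U), Module.Basis (Fin n) (O.sections V) (F.Sec V) :=
    fun V h => (b V h).dualBasis.map (LinearEquiv.ofBijective _ (hbij V h)).symm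
  have hc : ∀ (V : Opens X) (h : V ≤ U) i j,
      p.app V (E.res h (e i)) (c V h j) = if i = j then 1 else 0 := by
    intro V h i j
    have h1 : (p.app V).flip (c V h j) = (b V h).dualBasis j :=
      (LinearEquiv.ofBijective _ (hbij V h)).apply_symm_apply _
    rw [← LinearMap.flip_apply, h1, ← hb, Module.Basis.dualBasis_apply_self]
  have hdual : ∀ i j, p.app U (e i) (c U le_rfl j) = if i = j then 1 else 0 := fun i j => by
    have := hc U le_rfl i j
    rwa [E.res_self] at this
  -- Dual bases commute with restriction because they are determined by pairings `0` and `1`, which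
  -- restrict to themselves. Hence the dual basis over `U` is a frame on every smaller open set.
  have hres : ∀ (V : Opens X) (h : V ≤ U) j, F.res h (c U le_rfl j) = c V h j := by
    intro V h j
    apply (hbij V h).1
    apply (b V h).ext
    intro i
    rw [hb, LinearMap.flip_apply, LinearMap.flip_apply, hc, p.app_res, hdual]
    split_ifs <;> simp
  refine ⟨c U le_rfl, fun V h => ?_, hdual⟩
  simp only [hres]
  exact ⟨(c V h).linearIndependent, (c V h).span_eq.ge⟩

/-- Reflexivity of finite free modules: the map is evaluation into the bidual followed by the
transpose of `ℱ(U) ≅ ℰ(U)^*`. -/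
theorem bijective_app (hp : p.IsDual) {U : Opens X} {n : ℕ} {e : Fin n → E.Sec U}
    (he : E.IsFrame e) : Function.Bijective (p.app U) := by
  have hb := p.bijective_flip_app hp he
  let b : Module.Basis (Fin n) (O.sections U) (E.Sec U) :=
    Module.Basis.mk (he U le_rfl).1 (he U le_rfl).2
  have := Module.Finite.of_basis b
  have := Module.Free.of_basis b
  have h1 : p.app U = (LinearEquiv.ofBijective (p.app U).flip hb).dualMap.toLinearMap ∘ₗ
      Module.Dual.eval (O.sections U) (E.Sec U) := by
    ext D ξ
    rfl
  rw [h1]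
  exact (LinearEquiv.ofBijective (p.app U).flip hb).dualMap.bijective.comp (Module.bijective_dual_eval _ _)

/-- If `ℱ` is the dual of a locally free sheaf `ℰ` of finite rank, then `ℰ` is the dual of `ℱ`. -/
theorem isDual_flip (hp : p.IsDual) (hE : E.IsLocallyFree) : p.flip.IsDual := by
  intro U
  have hloc : ∀ x ∈ U, ∃ V : Opens X, V ≤ U ∧ x ∈ V ∧ E.IsFreeOn V := by
    intro x hx
    obtain ⟨V, hxV, n, e, he⟩ := hE x
    exact ⟨V ⊓ U, inf_le_right, ⟨hxV, hx⟩, n, _, IsFrame.restrict he inf_le_left⟩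
  constructor
  · intro D D' h
    refine LieAlgebroid.eq_of_locally_eq fun x hx => ?_
    obtain ⟨V, hV, hxV, n, e, he⟩ := hloc x hx
    refine ⟨V, hV, hxV, (bijective_app hp he).1 ?_⟩
    exact congrArg (fun φ : F.DualSection U => φ.app V hV) h
  · intro φ
    choose V hV hx hfree using hloc
    have hex : ∀ x hxU, ∃ D : E.Sec (V x hxU), p.app _ D = φ.app _ (hV x hxU) := by
      intro x hxU
      obtain ⟨n, e, he⟩ := hfree x hxU
      exact (bijective_app hp he).2 _
    choose D hD using hex
    -- The local section represents `φ` on every smaller open set as well: there both maps agree on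
    -- the restricted dual frame. Injectivity on overlaps then lets the local sections glue.
    have hDres : ∀ x hxU (W : Opens X) (hW : W ≤ V x hxU),
        p.app W (E.res hW (D x hxU)) = φ.app W (hW.trans (hV x hxU)) := by
      intro x hxU W hW
      obtain ⟨n, e, he⟩ := hfree x hxU
      obtain ⟨f, hf, -⟩ := exists_dual_frame hp he
      apply LinearMap.ext_on (top_le_iff.mp (hf W hW).2)
      rintro _ ⟨i, rfl⟩
      rw [p.app_res, hD, φ.app_res]
    have hU : ⨆ x : U, V x x.2 = U := by
      refine le_antisymm (iSup_le fun x => hV _ _) fun x hxU => ?_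
      exact (le_iSup (fun x : U => V x x.2) ⟨x, hxU⟩) (hx x hxU)
    obtain ⟨D₀, hD₀, -⟩ := existsUnique_gluing' _ hU (fun x => D x x.2) (by
      intro i j
      obtain ⟨n, e, he⟩ := hfree i i.2
      apply (bijective_app hp (IsFrame.restrict he
        (inf_le_left : V i i.2 ⊓ V j j.2 ≤ _))).1
      rw [hDres, hDres])
    refine ⟨D₀, DualSection.ext ?_⟩
    funext W hW
    refine LinearMap.ext fun ξ => StructureSheafOn.eq_of_locally_eq fun x hxW => ?_
    refine ⟨W ⊓ V x (hW hxW), inf_le_left, ⟨hxW, hx _ _⟩, ?_⟩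
    change O.res _ (p.app W (E.res hW D₀) ξ) = _
    rw [← p.app_res, ← φ.app_res, ← hDres x (hW hxW) _ inf_le_right, ← hD₀ ⟨x, hW hxW⟩,
      E.res_res, E.res_res]

end SheafPairing

/-- The dual of a Lie bialgebroid is a Lie bialgebroid. -/
theorem IsLieBialgebroid.flip {L : LieAlgebroid.{u, w₃, w} O}
    {E : LieAlgebroidOver.{u, w, w₁, w₃} L} {F : LieAlgebroidOver.{u, w, w₂, w₃} L} {p : SheafPairing E.toLieAlgebroid F.toLieAlgebroid}
    (h : IsLieBialgebroid E F p) : IsLieBialgebroid F E p.flip where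
  isLocallyFree_left := h.isLocallyFree_right
  isLocallyFree_right := h.isLocallyFree_left
  isDual := SheafPairing.isDual_flip h.isDual h.isLocallyFree_left
  compatibility := by
    intro U hU ξ η
    have hp := SheafPairing.isDual_flip h.isDual h.isLocallyFree_left
    -- The exchanged compatibility is tested where `ℱ` is free. The dual frame shows that `ℰ` is
    -- free on the same open set, so the hypothesis applies there.
    obtain ⟨n, f, hf⟩ := id hU
    obtain ⟨e, he, hfe⟩ := SheafPairing.exists_dual_frame hp hf
    have hB := p.bijective_flip_app h.isDual he
    have hB' := SheafPairing.bijective_app h.isDual he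
    refine (compatibility_iff_bialgebroidDefect_eq_zero (B := (p.app U).flip) hB' hB
      (p.flip.bivectorToForm_bijective hp hU) ξ η).2 fun D D' => ?_
    refine bialgebroidDefect_flip_eq_zero hB hB' (Module.Basis.mk (he U le_rfl).1 (he U le_rfl).2)
      f (fun i j => ?_) (fun D D' => ?_) D D' ξ η
    · rw [Module.Basis.mk_apply, E.toLieAlgebroid.res_self]
      exact (hfe j i).trans (by simp only [eq_comm])
    · exact (compatibility_iff_bialgebroidDefect_eq_zero hB hB'
        (p.bivectorToForm_bijective h.isDual ⟨n, e, he⟩) D D').1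
        (h.compatibility U ⟨n, e, he⟩ D D')

end Sheaves

theorem mainTheorem9 {K : Type w} [Field K] [CharZero K] [TopologicalSpace K]
    {X : Type u} [TopologicalSpace X] (O : StructureSheafOn K X)
    (L : LieAlgebroid.{u, w₃, w} O)
    (E : LieAlgebroidOver.{u, w, w₁, w₃} L) (F : LieAlgebroidOver.{u, w, w₂, w₃} L)
    (p : SheafPairing E.toLieAlgebroid F.toLieAlgebroid) :
    IsLieBialgebroid E F p ↔ IsLieBialgebroid F E p.flip :=
  -- `p.flip.flip` is `p` by definition.
  ⟨IsLieBialgebroid.flip, IsLieBialgebroid.flip (p := p.flip)⟩
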